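/- The language of C*-algebras in continuous logic has as its atomic formulae the norms $\|P(x_1,\dots,x_k)\|$ of $*$-polynomials with complex coefficients in non-commuting variables; formulae are built from these by finitary continuous real-valued connectives and by the quantifiers $\sup_{\|x\|\le 1}$ and $\inf_{\|x\|\le 1}$, and a sentence is a formula without free variables. A sentence $\varphi$ has a real value $\varphi^{\mathcal A}$ in every C*-algebra $\mathcal A$. A C*-algebra $\mathcal A$ is called pseudomatricial if $\varphi^{\mathcal A}=0$ for every sentence $\varphi$ such that $\varphi^{M_n(\mathbb C)}=0$ for all $n\ge 1$. **Proposition 6.8.** Pseudomatricial C*-algebras have strict comparison of projections. That is, a pseudomatricial C*-algebra $\mathcal A$ has a tracial state, and whenever $\mathrm{tr}$ is a tracial state on $\mathcal A$ and $p,q\in\mathcal A$ are projections with $\mathrm{tr}(q)<\mathrm{tr}(p)$, the projection $q$ is Murray–von Neumann equivalent to a proper subprojection of $p$: there are a projection $r\le p$ with $r\ne p$ and an element $v\in\mathcal A$ with $v^*v=q$ and $vv^*=r$. -/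

import Mathlib

open scoped ComplexOrder

/-- `*`-polynomials with complex coefficients in the non-commuting variables
`x₀, …, x_{n-1}`: the terms of the language of C⋆-algebras. -/
inductive CStarTerm (n : ℕ) : Type
  | var (i : Fin n) : CStarTerm n
  | zero : CStarTerm n
  | add (s t : CStarTerm n) : CStarTerm n
  | mul (s t : CStarTerm n) : CStarTerm n
  | smul (c : ℂ) (t : CStarTerm n) : CStarTerm n
  | star (t : CStarTerm n) : CStarTerm n

/-- Formulae of continuous logic in the language of C⋆-algebras with free variables
`x₀, …, x_{n-1}`: atomic formulae are norms of terms, connectives are continuous functions of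
finitely many real arguments, quantifiers are suprema and infima over the closed unit ball.
A quantifier binds the variable `x₀` of its body. -/
inductive CStarFormula : ℕ → Type
  | norm {n : ℕ} (t : CStarTerm n) : CStarFormula n
  | conn {n k : ℕ} (u : C(Fin k → ℝ, ℝ)) (φ : Fin k → CStarFormula n) : CStarFormula n
  | sup {n : ℕ} (φ : CStarFormula (n + 1)) : CStarFormula n
  | inf {n : ℕ} (φ : CStarFormula (n + 1)) : CStarFormula n

/-- A sentence is a formula without free variables. -/
abbrev CStarSentence : Type := CStarFormula 0

section Semantics

universe u

/-- The value of a term in a C⋆-algebra. -/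
def CStarTerm.eval {n : ℕ} (A : Type u) [NonUnitalCStarAlgebra A] (v : Fin n → A) :
    CStarTerm n → A
  | .var i => v i
  | .zero => 0
  | .add s t => s.eval A v + t.eval A v
  | .mul s t => s.eval A v * t.eval A v
  | .smul c t => c • t.eval A v
  | .star t => Star.star (t.eval A v)

/-- The value of a formula in a C⋆-algebra. The suprema and infima are over non-empty sets, and
these sets are bounded (see `CStarFormula.exists_bound`) when `v` lies in the unit ball, as is
always the case inside a sentence. -/
noncomputable def CStarFormula.eval (A : Type u) [NonUnitalCStarAlgebra A] :
    {n : ℕ} → CStarFormula n → (Fin n → A) → ℝ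
  | _, .norm t, v => ‖t.eval A v‖
  | _, .conn u φ, v => u fun i => (φ i).eval A v
  | _, .sup φ, v => ⨆ x : Metric.closedBall (0 : A) 1, φ.eval A (Matrix.vecCons (x : A) v)
  | _, .inf φ, v => ⨅ x : Metric.closedBall (0 : A) 1, φ.eval A (Matrix.vecCons (x : A) v)

/-- The value of a sentence in a C⋆-algebra. -/
noncomputable def CStarSentence.value (φ : CStarSentence) (A : Type u)
    [NonUnitalCStarAlgebra A] : ℝ :=
  CStarFormula.eval A φ Fin.elim0

theorem CStarTerm.exists_bound {n : ℕ} (A : Type u) [NonUnitalCStarAlgebra A]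
    (t : CStarTerm n) :
    ∃ C : ℝ, ∀ v : Fin n → A, (∀ i, ‖v i‖ ≤ 1) → ‖t.eval A v‖ ≤ C := by
  induction t with
  | var i => exact ⟨1, fun v hv => hv i⟩
  | zero => exact ⟨0, fun v hv => by simp [CStarTerm.eval]⟩
  | add s t hs ht =>
    obtain ⟨C, hC⟩ := hs
    obtain ⟨D, hD⟩ := ht
    exact ⟨C + D, fun v hv => (norm_add_le _ _).trans (add_le_add (hC v hv) (hD v hv))⟩
  | mul s t hs ht =>
    obtain ⟨C, hC⟩ := hs
    obtain ⟨D, hD⟩ := ht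
    exact ⟨C * D, fun v hv => (norm_mul_le _ _).trans (mul_le_mul (hC v hv) (hD v hv)
      (norm_nonneg _) ((norm_nonneg _).trans (hC v hv)))⟩
  | smul c t ht =>
    obtain ⟨C, hC⟩ := ht
    refine ⟨‖c‖ * C, fun v hv => ?_⟩
    rw [CStarTerm.eval, norm_smul]
    exact mul_le_mul_of_nonneg_left (hC v hv) (norm_nonneg _)
  | star t ht =>
    obtain ⟨C, hC⟩ := ht
    exact ⟨C, fun v hv => by rw [CStarTerm.eval, norm_star]; exact hC v hv⟩

/-- Every formula is bounded on the unit ball, so the quantifiers are genuine suprema and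
infima. -/
theorem CStarFormula.exists_bound {n : ℕ} (A : Type u) [NonUnitalCStarAlgebra A]
    (φ : CStarFormula n) :
    ∃ C : ℝ, ∀ v : Fin n → A, (∀ i, ‖v i‖ ≤ 1) → |φ.eval A v| ≤ C := by
  have hcons : ∀ {n : ℕ} (v : Fin n → A), (∀ i, ‖v i‖ ≤ 1) →
      ∀ x : Metric.closedBall (0 : A) 1, ∀ i, ‖Matrix.vecCons (x : A) v i‖ ≤ 1 := by
    intro n v hv x i
    refine Fin.cases ?_ (fun j => ?_) i
    · exact mem_closedBall_zero_iff.mp x.2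
    · exact hv j
  have hne : Nonempty (Metric.closedBall (0 : A) 1) := ⟨⟨0, by simp⟩⟩
  induction φ with
  | norm t =>
    obtain ⟨C, hC⟩ := t.exists_bound A
    exact ⟨C, fun v hv => by rw [CStarFormula.eval, abs_norm]; exact hC v hv⟩
  | conn u φ ih =>
    choose C hC using ih
    obtain ⟨D, hD⟩ := (isCompact_univ_pi fun i =>
      isCompact_Icc (a := -C i) (b := C i)).exists_bound_of_continuousOn u.continuous.continuousOn
    exact ⟨D, fun v hv => hD _ fun i _ => abs_le.mp (hC i v hv)⟩
  | sup φ ih =>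
    obtain ⟨C, hC⟩ := ih
    refine ⟨C, fun v hv => ?_⟩
    have h := fun x => abs_le.mp (hC _ (hcons v hv x))
    have hb : BddAbove (Set.range fun x : Metric.closedBall (0 : A) 1 =>
        φ.eval A (Matrix.vecCons (x : A) v)) := ⟨C, by rintro _ ⟨x, rfl⟩; exact (h x).2⟩
    obtain ⟨x⟩ := hne
    exact abs_le.mpr ⟨(h x).1.trans (le_ciSup hb x), ciSup_le fun y => (h y).2⟩
  | inf φ ih =>
    obtain ⟨C, hC⟩ := ih
    refine ⟨C, fun v hv => ?_⟩
    have h := fun x => abs_le.mp (hC _ (hcons v hv x))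
    have hb : BddBelow (Set.range fun x : Metric.closedBall (0 : A) 1 =>
        φ.eval A (Matrix.vecCons (x : A) v)) := ⟨-C, by rintro _ ⟨x, rfl⟩; exact (h x).1⟩
    obtain ⟨x⟩ := hne
    exact abs_le.mpr ⟨le_ciInf fun y => (h y).1, (ciInf_le hb x).trans (h x).2⟩

/-- A C⋆-algebra is pseudomatricial if every sentence that vanishes in all matrix algebras
`Mₙ(ℂ)`, `n ≥ 1` (with the operator norm), vanishes in it. -/
def IsPseudomatricial (A : Type u) [NonUnitalCStarAlgebra A] : Prop :=
  ∀ φ : CStarSentence,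
    (∀ n : ℕ, 1 ≤ n → φ.value (CStarMatrix (Fin n) (Fin n) ℂ) = 0) → φ.value A = 0

/-- A tracial state: a positive linear functional of norm one with `τ (a b) = τ (b a)`. -/
structure IsTracialState {A : Type u} [NonUnitalCStarAlgebra A] (τ : A →L[ℂ] ℂ) : Prop where
  nonneg : ∀ a : A, 0 ≤ τ (star a * a)
  norm_eq_one : ‖τ‖ = 1
  map_mul_comm : ∀ a b : A, τ (a * b) = τ (b * a)

/-- Murray–von Neumann equivalence of the projections `p` and `q`. -/
def MurrayVonNeumannEquiv {A : Type u} [NonUnitalCStarAlgebra A] (p q : A) : Prop :=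
  ∃ v : A, star v * v = p ∧ v * star v = q

/-- `r` is a proper subprojection of the projection `p`: a projection with `r ≤ p`, that is
`p r = r`, and `r ≠ p`. -/
structure IsProperSubprojection {A : Type u} [NonUnitalCStarAlgebra A] (r p : A) : Prop where
  isStarProjection : IsStarProjection r
  mul_eq : p * r = r
  ne : r ≠ p

end Semantics

/-! An inequality `φ ≤ 0` valid on the unit balls of all `Mₘ(ℂ)` passes to a pseudomatricial algebra
`A` (`IsPseudomatricial.eval_nonpos`), and three such inequalities suffice. The first says that
approximate units exist; by completeness they converge to a unit. The second says that `1` has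
distance at least one from every combination of commutators; Hahn–Banach then gives a tracial state.

The third says that any two projections are comparable, as ranks are in `Mₘ(ℂ)`. Quantifiers range
over the ball and not over projections, so it is stated for all `x⋆x` and `y⋆y`, with an error
measuring their failure to be idempotent (`CStarMatrix.exists_min_norm_sq_le`). At projections `p`,
`q` of `A` the error vanishes, and polar decomposition turns approximate comparison into equivalence
(`IsStarProjection.exists_murrayVonNeumannEquiv`). If `τ q < τ p`, then `p` cannot be equivalent to
a subprojection of `q`; so `q` is equivalent to one of `p`, and the traces make it proper. -/

/-! ### Transfer of universal inequalities -/

namespace CStarFormula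

/-- The sentence that takes the supremum over all free variables. -/
noncomputable def supAll : {n : ℕ} → CStarFormula n → CStarSentence
  | 0, φ => φ
  | _ + 1, φ => supAll φ.sup

theorem norm_vecCons_le_one {A : Type*} [Norm A] {n : ℕ} {v : Fin n → A} {x : A}
    (hx : ‖x‖ ≤ 1) (hv : ∀ i, ‖v i‖ ≤ 1) (i : Fin (n + 1)) :
    ‖(Matrix.vecCons x v : Fin (n + 1) → A) i‖ ≤ 1 :=
  Fin.cases hx hv i

theorem bddAbove_range_eval {A : Type*} [NonUnitalCStarAlgebra A] {n : ℕ}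
    (φ : CStarFormula (n + 1)) {v : Fin n → A} (hv : ∀ i, ‖v i‖ ≤ 1) :
    BddAbove (Set.range fun x : Metric.closedBall (0 : A) 1 =>
      φ.eval A (Matrix.vecCons (x : A) v)) := by
  obtain ⟨C, hC⟩ := φ.exists_bound A
  refine ⟨C, ?_⟩
  rintro _ ⟨x, rfl⟩
  exact (abs_le.mp (hC _ (norm_vecCons_le_one (mem_closedBall_zero_iff.mp x.2) hv))).2

theorem bddBelow_range_eval {A : Type*} [NonUnitalCStarAlgebra A] {n : ℕ}
    (φ : CStarFormula (n + 1)) {v : Fin n → A} (hv : ∀ i, ‖v i‖ ≤ 1) :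
    BddBelow (Set.range fun x : Metric.closedBall (0 : A) 1 =>
      φ.eval A (Matrix.vecCons (x : A) v)) := by
  obtain ⟨C, hC⟩ := φ.exists_bound A
  refine ⟨-C, ?_⟩
  rintro _ ⟨x, rfl⟩
  exact (abs_le.mp (hC _ (norm_vecCons_le_one (mem_closedBall_zero_iff.mp x.2) hv))).1

theorem eval_le_eval_sup {A : Type*} [NonUnitalCStarAlgebra A] {n : ℕ}
    (φ : CStarFormula (n + 1)) {v : Fin n → A} (hv : ∀ i, ‖v i‖ ≤ 1) {x : A} (hx : ‖x‖ ≤ 1) :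
    φ.eval A (Matrix.vecCons x v) ≤ φ.sup.eval A v :=
  le_ciSup (φ.bddAbove_range_eval hv) (⟨x, mem_closedBall_zero_iff.mpr hx⟩ : Metric.closedBall _ _)

theorem eval_inf_le_eval {A : Type*} [NonUnitalCStarAlgebra A] {n : ℕ}
    (φ : CStarFormula (n + 1)) {v : Fin n → A} (hv : ∀ i, ‖v i‖ ≤ 1) {x : A} (hx : ‖x‖ ≤ 1) :
    φ.inf.eval A v ≤ φ.eval A (Matrix.vecCons x v) :=
  ciInf_le (φ.bddBelow_range_eval hv) (⟨x, mem_closedBall_zero_iff.mpr hx⟩ : Metric.closedBall _ _)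

theorem eval_sup_le {A : Type*} [NonUnitalCStarAlgebra A] {n : ℕ}
    (φ : CStarFormula (n + 1)) {v : Fin n → A} {c : ℝ}
    (h : ∀ x : A, ‖x‖ ≤ 1 → φ.eval A (Matrix.vecCons x v) ≤ c) : φ.sup.eval A v ≤ c :=
  have : Nonempty (Metric.closedBall (0 : A) 1) := ⟨⟨0, by simp⟩⟩
  ciSup_le fun x => h x (mem_closedBall_zero_iff.mp x.2)

theorem exists_eval_lt {A : Type*} [NonUnitalCStarAlgebra A] {n : ℕ}
    (φ : CStarFormula (n + 1)) {v : Fin n → A} {c : ℝ} (h : φ.inf.eval A v < c) :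
    ∃ x : A, ‖x‖ ≤ 1 ∧ φ.eval A (Matrix.vecCons x v) < c :=
  have : Nonempty (Metric.closedBall (0 : A) 1) := ⟨⟨0, by simp⟩⟩
  let ⟨x, hx⟩ := exists_lt_of_ciInf_lt h
  ⟨x, mem_closedBall_zero_iff.mp x.2, hx⟩

theorem value_supAll_le {A : Type*} [NonUnitalCStarAlgebra A] {n : ℕ} (φ : CStarFormula n) {c : ℝ}
    (h : ∀ v : Fin n → A, (∀ i, ‖v i‖ ≤ 1) → φ.eval A v ≤ c) : φ.supAll.value A ≤ c := by
  induction n with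
  | zero => exact h _ fun i => i.elim0
  | succ n ih =>
    exact ih φ.sup fun v hv => φ.eval_sup_le fun x hx => h _ (norm_vecCons_le_one hx hv)

theorem eval_le_value_supAll {A : Type*} [NonUnitalCStarAlgebra A] {n : ℕ} (φ : CStarFormula n)
    (v : Fin n → A) (hv : ∀ i, ‖v i‖ ≤ 1) : φ.eval A v ≤ φ.supAll.value A := by
  induction n with
  | zero => exact (congrArg (φ.eval A) (Subsingleton.elim _ _)).le
  | succ n ih =>
    rw [← Matrix.cons_head_tail v]
    exact (φ.eval_le_eval_sup (fun i => hv i.succ) (hv 0)).trans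
      (ih φ.sup (Matrix.vecTail v) fun i => hv i.succ)

end CStarFormula

/-- Universal conditions that hold in all matrix algebras hold in pseudomatricial algebras. -/
theorem IsPseudomatricial.eval_nonpos {A : Type*} [NonUnitalCStarAlgebra A]
    (hA : IsPseudomatricial A) {n : ℕ} (φ : CStarFormula n)
    (h : ∀ m : ℕ, 1 ≤ m → ∀ v : Fin n → CStarMatrix (Fin m) (Fin m) ℂ, (∀ i, ‖v i‖ ≤ 1) →
      φ.eval (CStarMatrix (Fin m) (Fin m) ℂ) v ≤ 0)
    (v : Fin n → A) (hv : ∀ i, ‖v i‖ ≤ 1) : φ.eval A v ≤ 0 := by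
  -- Pseudomaticiality concerns vanishing only; the positive part encodes an inequality as an
  -- equation.
  have key : CStarSentence.value (.conn (k := 1) ⟨fun t => max (t 0) 0, by fun_prop⟩
      fun _ => φ.supAll) A = 0 :=
    hA _ fun m hm => max_eq_right (φ.value_supAll_le (h m hm))
  exact (φ.eval_le_value_supAll v hv).trans (max_eq_right_iff.mp key)

/-! ### The unit -/

/-- A pseudomatricial algebra is unital. -/
theorem IsPseudomatricial.exists_one {A : Type*} [i : NonUnitalCStarAlgebra A]
    (hA : IsPseudomatricial A) : ∃ e : A, ∀ x : A, e * x = x ∧ x * e = x := by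
  let φ : CStarFormula 0 := .inf (.sup (.conn (k := 2) ⟨fun t => t 0 + t 1, by fun_prop⟩
    ![.norm (.add (.mul (.var 1) (.var 0)) (.smul (-1) (.var 0))),
      .norm (.add (.mul (.var 0) (.var 1)) (.smul (-1) (.var 0)))]))
  have hφ := hA.eval_nonpos φ (fun m hm v hv => by
    have : NeZero m := ⟨by omega⟩
    refine (CStarFormula.eval_inf_le_eval _ hv (x := 1) CStarRing.norm_one.le).trans ?_
    refine CStarFormula.eval_sup_le _ fun x hx => ?_
    simp [CStarFormula.eval, CStarTerm.eval]) Fin.elim0 fun i => i.elim0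
  have happrox : ∀ ε : ℝ, 0 < ε → ∃ e : A, ‖e‖ ≤ 1 ∧
      ∀ x : A, ‖x‖ ≤ 1 → ‖e * x - x‖ ≤ ε ∧ ‖x * e - x‖ ≤ ε := by
    intro ε hε
    obtain ⟨e, he, h⟩ := CStarFormula.exists_eval_lt _ (hφ.trans_lt hε)
    refine ⟨e, he, fun x hx => ?_⟩
    have h' := (CStarFormula.eval_le_eval_sup _ (CStarFormula.norm_vecCons_le_one he
      fun i => i.elim0) hx).trans h.le
    simp only [CStarFormula.eval, CStarTerm.eval, ContinuousMap.coe_mk, Matrix.cons_val_zero,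
      Matrix.cons_val_one, neg_smul, one_smul, ← sub_eq_add_neg] at h'
    exact ⟨(le_add_of_nonneg_right (norm_nonneg _)).trans h',
      (le_add_of_nonneg_left (norm_nonneg _)).trans h'⟩
  choose e he h using fun n : ℕ => happrox (1 / (n + 1)) (by positivity)
  have hlim : Filter.Tendsto (fun n : ℕ => 1 / ((n : ℝ) + 1)) Filter.atTop (nhds 0) :=
    tendsto_one_div_add_atTop_nhds_zero_nat
  have hcauchy : CauchySeq e := by
    refine cauchySeq_of_le_tendsto_0 (fun n : ℕ => 2 * (1 / ((n : ℝ) + 1))) ?_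
      (by simpa using hlim.const_mul 2)
    intro n m N hn hm
    -- The product `e n * e m` is close to both of its factors.
    have h1 := (h n (e m) (he m)).1
    have h2 := (h m (e n) (he n)).2
    have hn' : 1 / ((n : ℝ) + 1) ≤ 1 / ((N : ℝ) + 1) := by gcongr
    have hm' : 1 / ((m : ℝ) + 1) ≤ 1 / ((N : ℝ) + 1) := by gcongr
    calc dist (e n) (e m) = ‖(e n * e m - e m) - (e n * e m - e n)‖ := by
          rw [dist_eq_norm]; congr 1; abel
      _ ≤ _ := norm_sub_le _ _
      _ ≤ _ := by linarith
  obtain ⟨u, hu⟩ := cauchySeq_tendsto_of_complete hcauchy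
  have hball : ∀ x : A, ‖x‖ ≤ 1 → u * x = x ∧ x * u = x := by
    intro x hx
    constructor
    · refine tendsto_nhds_unique (hu.mul_const x) ?_
      exact tendsto_iff_norm_sub_tendsto_zero.mpr
        (squeeze_zero (fun _ => norm_nonneg _) (fun n => (h n x hx).1) hlim)
    · refine tendsto_nhds_unique (hu.const_mul x) ?_
      exact tendsto_iff_norm_sub_tendsto_zero.mpr
        (squeeze_zero (fun _ => norm_nonneg _) (fun n => (h n x hx).2) hlim)
  refine ⟨u, fun x => ?_⟩
  have hc : ((‖x‖ + 1 : ℝ) : ℂ) ≠ 0 := by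
    exact_mod_cast (by positivity : ‖x‖ + 1 ≠ 0)
  have hx : ‖((‖x‖ + 1 : ℝ) : ℂ)⁻¹ • x‖ ≤ 1 := by
    rw [norm_smul, norm_inv, Complex.norm_real, Real.norm_of_nonneg (by positivity)]
    exact inv_mul_le_one_of_le₀ (by linarith) (by positivity)
  have := hball _ hx
  rw [mul_smul_comm, smul_mul_assoc] at this
  exact ⟨smul_right_injective A (inv_ne_zero hc) this.1,
    smul_right_injective A (inv_ne_zero hc) this.2⟩

/-- A non-unital C⋆-algebra with a unit is a C⋆-algebra. -/
theorem NonUnitalCStarAlgebra.exists_eq_toNonUnitalCStarAlgebra {A : Type*}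
    [i : NonUnitalCStarAlgebra A] (h : ∃ e : A, ∀ x : A, e * x = x ∧ x * e = x) :
    ∃ j : CStarAlgebra A, i = @CStarAlgebra.toNonUnitalCStarAlgebra A j := by
  obtain ⟨e, he⟩ := h
  let r : NormedRing A :=
    { i.toNonUnitalNormedRing with
      one := e
      one_mul := fun x => (he x).1
      mul_one := fun x => (he x).2 }
  let al : Algebra ℂ A := Algebra.ofModule smul_mul_assoc mul_smul_comm
  let na : NormedAlgebra ℂ A := { al with norm_smul_le := norm_smul_le }
  -- Norm and operations are unchanged, so the instances agree definitionally and `i` can later be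
  -- substituted away.
  exact ⟨{ i, r, na with }, rfl⟩

/-! ### The tracial state -/

/-- Finite sums of terms. -/
def CStarTerm.sum {n : ℕ} : {k : ℕ} → (Fin k → CStarTerm n) → CStarTerm n
  | 0, _ => .zero
  | _ + 1, t => .add (t 0) (CStarTerm.sum fun i => t i.succ)

theorem CStarTerm.eval_sum {A : Type*} [NonUnitalCStarAlgebra A] {n k : ℕ}
    (t : Fin k → CStarTerm n) (v : Fin n → A) :
    (CStarTerm.sum t).eval A v = ∑ i, (t i).eval A v := by
  induction k with
  | zero => simp [CStarTerm.sum, CStarTerm.eval]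
  | succ k ih => rw [Fin.sum_univ_succ, ← ih]; rfl

/-- Commutators have trace zero, so the trace of the difference is `m`, while each of its `m`
diagonal entries is bounded by its norm. -/
theorem CStarMatrix.one_le_norm_one_sub_sum_commutator {m k : ℕ} (hm : 1 ≤ m) (c : Fin k → ℂ)
    (x y : Fin k → CStarMatrix (Fin m) (Fin m) ℂ) :
    1 ≤ ‖1 - ∑ i, c i • (x i * y i - y i * x i)‖ := by
  set s := ∑ i, c i • (x i * y i - y i * x i) with hs
  let T : CStarMatrix (Fin m) (Fin m) ℂ →ₗ[ℂ] ℂ :=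
    Matrix.traceLinearMap (Fin m) ℂ ℂ ∘ₗ (CStarMatrix.ofMatrixₗ (R := ℂ)).symm.toLinearMap
  have hT : ∀ a b, T (a * b) = T (b * a) := fun a b =>
    Matrix.trace_mul_comm (CStarMatrix.ofMatrix.symm a) (CStarMatrix.ofMatrix.symm b)
  have hs0 : ∑ j, s j j = 0 := by
    change T s = 0
    rw [hs, map_sum]
    refine Finset.sum_eq_zero fun i _ => ?_
    rw [map_smul, map_sub, hT, sub_self, smul_zero]
  have htr : ∑ j, (1 - s) j j = m := by simp [hs0]
  have hle : ‖∑ j, (1 - s) j j‖ ≤ m * ‖1 - s‖ := by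
    refine (norm_sum_le_of_le _ fun j _ => CStarMatrix.norm_entry_le_norm).trans ?_
    simp
  rw [htr, Complex.norm_natCast] at hle
  have : (0 : ℝ) < m := by exact_mod_cast hm
  exact le_of_mul_le_mul_left (by simpa using hle) this

theorem IsPseudomatricial.one_le_norm_one_sub_sum_commutator {A : Type*} [CStarAlgebra A]
    (hA : IsPseudomatricial A) {k : ℕ} (c : Fin k → ℂ) (x y : Fin k → A)
    (hx : ∀ i, ‖x i‖ ≤ 1) (hy : ∀ i, ‖y i‖ ≤ 1) :
    1 ≤ ‖1 - ∑ i, c i • (x i * y i - y i * x i)‖ := by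
  let f := (Fintype.equivFin (Option (Fin k ⊕ Fin k)))
  let X (i : Fin k) := CStarTerm.var (f (some (.inl i)))
  let Y (i : Fin k) := CStarTerm.var (f (some (.inr i)))
  -- The language has no constant `1`. The variable `f none` stands in for it, and the supremum,
  -- which bounds its distance to `1`, pays for the replacement.
  let φ : CStarFormula (Fintype.card (Option (Fin k ⊕ Fin k))) :=
    .conn (k := 2) ⟨fun t => 1 - t 0 - t 1, by fun_prop⟩
    ![.norm (.add (.var (f none)) (.smul (-1) (.sum fun i => .smul (c i)
        (.add (.mul (X i) (Y i)) (.smul (-1) (.mul (Y i) (X i))))))),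
      .sup (.norm (.add (.mul (.var (f none).succ) (.var 0)) (.smul (-1) (.var 0))))]
  have hunit : ‖(1 : A)‖ ≤ 1 := by
    cases subsingleton_or_nontrivial A
    · rw [Subsingleton.elim (1 : A) 0, norm_zero]; exact zero_le_one
    · exact CStarRing.norm_one.le
  let w : Option (Fin k ⊕ Fin k) → A := fun o => o.elim 1 (Sum.elim x y)
  have hw : ∀ o, ‖w o‖ ≤ 1 := by
    rintro (_ | i | i)
    exacts [hunit, hx i, hy i]
  have h := hA.eval_nonpos φ (fun m hm v hv => by
    have : NeZero m := ⟨by omega⟩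
    have h1 := CStarMatrix.one_le_norm_one_sub_sum_commutator hm c
      (fun i => v (f (some (.inl i)))) (fun i => v (f (some (.inr i))))
    have h2 := CStarFormula.eval_le_eval_sup (.norm (.add (.mul (.var (f none).succ) (.var 0))
      (.smul (-1) (.var 0)))) hv (x := 1) CStarRing.norm_one.le
    simp only [CStarFormula.eval, CStarTerm.eval, Matrix.cons_val_zero, Matrix.cons_val_succ,
      mul_one, neg_smul, one_smul, ← sub_eq_add_neg] at h2
    simp only [φ, X, Y, CStarFormula.eval, CStarTerm.eval, CStarTerm.eval_sum,
      ContinuousMap.coe_mk, Matrix.cons_val_zero, Matrix.cons_val_one, Matrix.cons_val_succ,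
      neg_smul, one_smul, ← sub_eq_add_neg]
    have h3 := norm_sub_le_norm_sub_add_norm_sub (1 : CStarMatrix (Fin m) (Fin m) ℂ) (v (f none))
      (∑ i, c i • (v (f (some (.inl i))) * v (f (some (.inr i))) -
        v (f (some (.inr i))) * v (f (some (.inl i)))))
    rw [norm_sub_rev _ (v (f none))] at h3
    linarith) (fun j => w (f.symm j)) fun j => hw _
  simp only [φ, X, Y, CStarFormula.eval, CStarTerm.eval, CStarTerm.eval_sum,
    ContinuousMap.coe_mk, Matrix.cons_val_zero, Matrix.cons_val_one, Matrix.cons_val_succ,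
    neg_smul, one_smul, ← sub_eq_add_neg, Equiv.symm_apply_apply, w, Option.elim, Sum.elim_inl,
    Sum.elim_inr, one_mul, sub_self, norm_zero] at h
  have : Nonempty (Metric.closedBall (0 : A) 1) := ⟨⟨0, by simp⟩⟩
  simp only [ciSup_const] at h
  linarith

/-- A unital functional of norm at most one is positive. -/
theorem CStarAlgebra.nonneg_of_norm_le_one_of_map_one {A : Type*} [CStarAlgebra A] (τ : A →L[ℂ] ℂ)
    (hτ : ‖τ‖ ≤ 1) (h1 : τ 1 = 1) (a : A) : 0 ≤ τ (star a * a) := by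
  let _ := CStarAlgebra.spectralOrder A
  have := CStarAlgebra.spectralOrderedRing A
  set b := star a * a
  have hb : 0 ≤ b := star_mul_self_nonneg a
  have hbs : IsSelfAdjoint b := .star_mul_self a
  have hbound : ∀ x, ‖τ x‖ ≤ ‖x‖ := fun x =>
    (τ.le_opNorm x).trans (mul_le_of_le_one_left (norm_nonneg _) hτ)
  have him : (τ b).im = 0 := by
    have key : ∀ t : ℝ, ((τ b).im + t) ^ 2 ≤ ‖b‖ ^ 2 + t ^ 2 := by
      intro t
      have h2 : ‖b + ((t : ℂ) * Complex.I) • (1 : A)‖ ^ 2 ≤ ‖b‖ ^ 2 + t ^ 2 := by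
        have hstar : star (b + ((t : ℂ) * Complex.I) • (1 : A)) *
            (b + ((t : ℂ) * Complex.I) • (1 : A)) = b * b + ((t ^ 2 : ℝ) : ℂ) • (1 : A) := by
          rw [star_add, hbs.star_eq, star_smul, star_one]
          simp only [add_mul, mul_add, smul_add, smul_mul_assoc, mul_smul_comm, one_mul, mul_one,
            smul_smul, star_mul', RCLike.star_def, Complex.conj_ofReal, Complex.conj_I]
          have : (t : ℂ) * Complex.I * ((t : ℂ) * -Complex.I) = ((t ^ 2 : ℝ) : ℂ) := by
            push_cast; linear_combination (-(t : ℂ) ^ 2) * Complex.I_sq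
          rw [this, mul_neg, neg_smul]
          abel
        rw [sq, ← CStarRing.norm_star_mul_self, hstar]
        refine (norm_add_le _ _).trans (add_le_add ?_ ?_)
        · rw [sq]; exact norm_mul_le _ _
        · rw [norm_smul, Complex.norm_real, Real.norm_of_nonneg (sq_nonneg t)]
          refine mul_le_of_le_one_right (sq_nonneg t) ?_
          cases subsingleton_or_nontrivial A
          · rw [Subsingleton.elim (1 : A) 0, norm_zero]; exact zero_le_one
          · exact CStarRing.norm_one.le
      have h3 : ((τ b).im + t) ^ 2 ≤ ‖τ (b + ((t : ℂ) * Complex.I) • (1 : A))‖ ^ 2 := by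
        rw [map_add, map_smul, h1, ← Complex.normSq_eq_norm_sq, Complex.normSq_apply]
        simp
        nlinarith [mul_self_nonneg (τ b).re]
      have h4 := pow_le_pow_left₀ (norm_nonneg _) (hbound (b + ((t : ℂ) * Complex.I) • (1 : A))) 2
      linarith
    by_contra hne
    -- With this `t` the cross term is `‖b‖ ^ 2 + 1`, and `key` would give `(τ b).im ^ 2 + 1 ≤ 0`.
    have h := key ((‖b‖ ^ 2 + 1) / (2 * (τ b).im))
    have h' : 2 * (τ b).im * ((‖b‖ ^ 2 + 1) / (2 * (τ b).im)) = ‖b‖ ^ 2 + 1 := by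
      field_simp
    nlinarith [sq_nonneg (τ b).im]
  have hre : 0 ≤ (τ b).re := by
    have hle : ‖algebraMap ℝ A ‖b‖ - b‖ ≤ ‖b‖ := by
      rw [CStarAlgebra.norm_le_iff_le_algebraMap _ (norm_nonneg _)
        (sub_nonneg.mpr hbs.le_algebraMap_norm_self)]
      exact sub_le_self _ hb
    have h2 := (Complex.re_le_norm _).trans ((hbound _).trans hle)
    rw [map_sub, Algebra.algebraMap_eq_smul_one, ← Complex.coe_smul, map_smul, h1] at h2
    simp at h2
    exact h2
  rw [Complex.le_def]
  exact ⟨hre, him.symm⟩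

/-- The entries of the commutators are rescaled into the unit ball, and the scalars are absorbed
into the coefficients. -/
theorem IsPseudomatricial.one_le_norm_one_sub {A : Type*} [CStarAlgebra A]
    (hA : IsPseudomatricial A) {s : A}
    (hs : s ∈ Submodule.span ℂ {z : A | ∃ x y : A, z = x * y - y * x}) : 1 ≤ ‖1 - s‖ := by
  obtain ⟨k, c, g, rfl⟩ := Submodule.mem_span_set'.mp hs
  choose x y hxy using fun i => (g i).2
  have hscale : ∀ z : A, ∃ (r : ℂ) (z' : A), ‖z'‖ ≤ 1 ∧ z = r • z' := by
    intro z
    have hc : ((‖z‖ + 1 : ℝ) : ℂ) ≠ 0 := by exact_mod_cast (by positivity : ‖z‖ + 1 ≠ 0)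
    refine ⟨((‖z‖ + 1 : ℝ) : ℂ), ((‖z‖ + 1 : ℝ) : ℂ)⁻¹ • z, ?_, (smul_inv_smul₀ hc z).symm⟩
    rw [norm_smul, norm_inv, Complex.norm_real, Real.norm_of_nonneg (by positivity)]
    exact inv_mul_le_one_of_le₀ (by linarith) (by positivity)
  choose a x' hx' hax using fun i => hscale (x i)
  choose b y' hy' hby using fun i => hscale (y i)
  convert hA.one_le_norm_one_sub_sum_commutator (fun i => c i * (a i * b i)) x' y' hx' hy' using 4
    with i
  rw [hxy, hax, hby]
  simp only [smul_mul_smul_comm, mul_smul, smul_sub, mul_comm (b i) (a i)]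

/-- The class of `1` has norm one modulo the span `S` of the commutators. A norming functional on `A
⧸ S` pulls back to a trace, positive because it is contractive and unital. `S` need not be closed:
the quotient seminorm is enough. -/
theorem IsPseudomatricial.exists_isTracialState {A : Type*} [CStarAlgebra A]
    (hA : IsPseudomatricial A) : ∃ τ : A →L[ℂ] ℂ, IsTracialState τ := by
  set S := Submodule.span ℂ {z : A | ∃ x y : A, z = x * y - y * x}
  have hnorm : ‖(1 : A)‖ = 1 := by
    have : Nontrivial A := by
      by_contra h
      rw [not_nontrivial_iff_subsingleton] at h
      have := hA.one_le_norm_one_sub (Submodule.zero_mem _)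
      rw [Subsingleton.elim (1 - 0 : A) 0, norm_zero] at this
      linarith
    exact CStarRing.norm_one
  let u : A ⧸ S := Submodule.Quotient.mk 1
  have hu : ‖u‖ = 1 := by
    refine le_antisymm ((Submodule.Quotient.norm_mk_le S 1).trans hnorm.le) ?_
    refine QuotientAddGroup.le_norm_iff.mpr fun m hm => ?_
    have hmem : 1 - m ∈ S := (Submodule.Quotient.eq S).mp hm.symm
    simpa using hA.one_le_norm_one_sub hmem
  obtain ⟨g, hg, hgu⟩ := exists_dual_vector ℂ u (by rw [hu]; exact one_ne_zero)
  let τ : A →L[ℂ] ℂ := (g.toLinearMap ∘ₗ S.mkQ).mkContinuous 1 fun a => by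
    rw [one_mul]
    refine (g.le_opNorm _).trans ?_
    rw [hg, one_mul]
    exact Submodule.Quotient.norm_mk_le S a
  have h1 : τ 1 = 1 := by
    change g u = 1
    rw [hgu, hu]; simp
  have hle : ‖τ‖ ≤ 1 := LinearMap.mkContinuous_norm_le _ zero_le_one _
  refine ⟨τ, CStarAlgebra.nonneg_of_norm_le_one_of_map_one τ hle h1, le_antisymm hle ?_, ?_⟩
  · simpa [h1, hnorm] using τ.le_opNorm 1
  · intro a b
    change g (Submodule.Quotient.mk (a * b)) = g (Submodule.Quotient.mk (b * a))
    rw [(Submodule.Quotient.eq S).mpr (Submodule.subset_span ⟨a, b, rfl⟩)]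

/-! ### Approximate comparison in matrix algebras -/

namespace CStarMatrix

/-- The copy of `ℂᵐ` in `Mₘ(ℂ)` consisting of the matrices that are diagonal with respect to the
columns of the unitary matrix `U`. -/
noncomputable def conjDiagonal {m : ℕ} (U : unitary (CStarMatrix (Fin m) (Fin m) ℂ)) :
    (Fin m → ℂ) →⋆ₙₐ[ℂ] CStarMatrix (Fin m) (Fin m) ℂ :=
  ((Unitary.conjStarAlgAut ℂ _ U : CStarMatrix (Fin m) (Fin m) ℂ ≃⋆ₐ[ℂ] _) :
      CStarMatrix (Fin m) (Fin m) ℂ →⋆ₙₐ[ℂ] _).comp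
    { toFun := fun d => ofMatrix (Matrix.diagonal d)
      map_smul' := fun c d => congrArg ofMatrix (Matrix.diagonal_smul c d)
      map_zero' := congrArg ofMatrix Matrix.diagonal_zero
      map_add' := fun d e => congrArg ofMatrix (Matrix.diagonal_add d e).symm
      map_mul' := fun d e => congrArg ofMatrix (Matrix.diagonal_mul_diagonal' d e).symm
      map_star' := fun d => congrArg ofMatrix (Matrix.diagonal_conjTranspose d).symm }

theorem conjDiagonal_apply {m : ℕ} (U : unitary (CStarMatrix (Fin m) (Fin m) ℂ))
    (d : Fin m → ℂ) : conjDiagonal U d =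
      U * ofMatrix (Matrix.diagonal d) * star (U : CStarMatrix (Fin m) (Fin m) ℂ) := rfl

/-- Injective `*`-homomorphisms are isometric. This reduces norm estimates to estimates on
eigenvalues. -/
theorem norm_conjDiagonal {m : ℕ} (U : unitary (CStarMatrix (Fin m) (Fin m) ℂ))
    (d : Fin m → ℂ) : ‖conjDiagonal U d‖ = ‖d‖ := by
  refine NonUnitalStarAlgHom.norm_map _ (fun d e h => ?_) d
  exact Matrix.diagonal_injective (ofMatrix.injective ((Unitary.conjStarAlgAut ℂ _ U).injective h))

theorem conj_conjDiagonal {m : ℕ} (U V : unitary (CStarMatrix (Fin m) (Fin m) ℂ))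
    (d : Fin m → ℂ) : U * star (V : CStarMatrix (Fin m) (Fin m) ℂ) * conjDiagonal V d *
      star (U * star (V : CStarMatrix (Fin m) (Fin m) ℂ)) = conjDiagonal U d := by
  simp only [conjDiagonal_apply, star_mul, star_star]
  simp only [mul_assoc]
  rw [← mul_assoc (star (V : CStarMatrix (Fin m) (Fin m) ℂ)) V, Unitary.coe_star_mul_self, one_mul,
    ← mul_assoc (star (V : CStarMatrix (Fin m) (Fin m) ℂ)) V, Unitary.coe_star_mul_self, one_mul]

/-- Positive matrices `a` and `b` can be diagonalised with their eigenvalues in the same order. -/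
theorem exists_eq_conjDiagonal {m : ℕ} (x y : CStarMatrix (Fin m) (Fin m) ℂ) :
    ∃ (U V : unitary (CStarMatrix (Fin m) (Fin m) ℂ)) (d e : Fin m → ℝ),
      star x * x = conjDiagonal U (fun i => (d i : ℂ)) ∧
      star y * y = conjDiagonal V (fun i => (e i : ℂ)) ∧
      (∀ i, 0 ≤ d i) ∧ (∀ i, 0 ≤ e i) ∧
      ∀ i j, (d i ≤ d j ∧ e i ≤ e j) ∨ (d j ≤ d i ∧ e j ≤ e i) := by
  have hx := Matrix.posSemidef_conjTranspose_mul_self (ofMatrix.symm x)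
  have hy := Matrix.posSemidef_conjTranspose_mul_self (ofMatrix.symm y)
  refine ⟨hx.1.eigenvectorUnitary, hy.1.eigenvectorUnitary, hx.1.eigenvalues, hy.1.eigenvalues,
    hx.1.spectral_theorem, hy.1.spectral_theorem, hx.eigenvalues_nonneg, hy.eigenvalues_nonneg,
    fun i j => ?_⟩
  -- Both eigenvalue lists are antitone after the same reindexing of `Fin m`.
  rcases le_total ((Fintype.equivOfCardEq (Fintype.card_fin _)).symm i : Fin (Fintype.card (Fin m)))
    ((Fintype.equivOfCardEq (Fintype.card_fin _)).symm j) with h | h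
  · exact .inr ⟨hx.1.eigenvalues₀_antitone h, hy.1.eigenvalues₀_antitone h⟩
  · exact .inl ⟨hx.1.eigenvalues₀_antitone h, hy.1.eigenvalues₀_antitone h⟩

/-- Any two positive contractive matrices are comparable, up to the error by which they fail to be
projections. -/
theorem exists_min_norm_sq_le {m : ℕ} [NeZero m] (x y : CStarMatrix (Fin m) (Fin m) ℂ)
    (hx : ‖x‖ ≤ 1) (hy : ‖y‖ ≤ 1) :
    ∃ u : CStarMatrix (Fin m) (Fin m) ℂ, ‖u‖ ≤ 1 ∧
      min ‖star y * y * star u * (star x * x) * u * (star y * y) - star y * y‖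
        ‖star x * x * u * (star y * y) * star u * (star x * x) - star x * x‖ ^ 2 ≤
      2 * max ‖star x * x * (star x * x) - star x * x‖ ‖star y * y * (star y * y) - star y * y‖ := by
  obtain ⟨U, V, d, e, hd, he, hd0, he0, hde⟩ := exists_eq_conjDiagonal x y
  have hcontr : ∀ {z : CStarMatrix (Fin m) (Fin m) ℂ} {W : unitary (CStarMatrix (Fin m) (Fin m) ℂ)}
      {f : Fin m → ℝ}, ‖z‖ ≤ 1 → star z * z = conjDiagonal W (fun i => (f i : ℂ)) →
      ∀ i, f i ≤ 1 := by
    intro z W f hz h i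
    have h1 : ‖star z * z‖ ≤ 1 := by
      exact (norm_mul_le _ _).trans (mul_le_one₀ ((norm_star z).trans_le hz) (norm_nonneg _) hz)
    rw [h, norm_conjDiagonal] at h1
    have h2 := (norm_le_pi_norm (fun i => (f i : ℂ)) i).trans h1
    rw [Complex.norm_real] at h2
    exact (le_abs_self _).trans h2
  have hd1 := hcontr hx hd
  have he1 := hcontr hy he
  refine ⟨U * star (V : CStarMatrix (Fin m) (Fin m) ℂ), ?_, ?_⟩
  · exact (CStarRing.norm_of_mem_unitary (U * star V).2).le
  set u : CStarMatrix (Fin m) (Fin m) ℂ := U * star (V : CStarMatrix (Fin m) (Fin m) ℂ) with hu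
  have h1 : star u * (star x * x) * u = conjDiagonal V (fun i => (d i : ℂ)) := by
    rw [hd, ← conj_conjDiagonal V U, hu, star_mul, star_mul, star_star, star_star]
  have h2 : u * (star y * y) * star u = conjDiagonal U (fun i => (e i : ℂ)) := by
    rw [he, ← conj_conjDiagonal U V]
  have e1 : star y * y * star u * (star x * x) * u * (star y * y) - star y * y =
      conjDiagonal V (fun i => ((e i * d i * e i - e i : ℝ) : ℂ)) := by
    rw [show star y * y * star u * (star x * x) * u * (star y * y) =
      star y * y * (star u * (star x * x) * u) * (star y * y) by simp only [mul_assoc], h1, he,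
      ← map_mul, ← map_mul, ← map_sub]
    congr 1; ext i; simp
  have e2 : star x * x * u * (star y * y) * star u * (star x * x) - star x * x =
      conjDiagonal U (fun i => ((d i * e i * d i - d i : ℝ) : ℂ)) := by
    rw [show star x * x * u * (star y * y) * star u * (star x * x) =
      star x * x * (u * (star y * y) * star u) * (star x * x) by simp only [mul_assoc], h2, hd,
      ← map_mul, ← map_mul, ← map_sub]
    congr 1; ext i; simp
  have e3 : star x * x * (star x * x) - star x * x =
      conjDiagonal U (fun i => ((d i * d i - d i : ℝ) : ℂ)) := by
    rw [hd, ← map_mul, ← map_sub]; congr 1; ext i; simp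
  have e4 : star y * y * (star y * y) - star y * y =
      conjDiagonal V (fun i => ((e i * e i - e i : ℝ) : ℂ)) := by
    rw [he, ← map_mul, ← map_sub]; congr 1; ext i; simp
  rw [e1, e2, e3, e4]
  simp only [norm_conjDiagonal]
  set N := max ‖fun i => ((d i * d i - d i : ℝ) : ℂ)‖ ‖fun i => ((e i * e i - e i : ℝ) : ℂ)‖
  have hN : 0 ≤ N := le_max_of_le_left (norm_nonneg _)
  have hdN : ∀ i, d i * (1 - d i) ≤ N := fun i => by
    have h : ‖((d i * d i - d i : ℝ) : ℂ)‖ ≤ N :=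
      (norm_le_pi_norm (fun i => ((d i * d i - d i : ℝ) : ℂ)) i).trans (le_max_left _ _)
    rw [Complex.norm_real] at h
    have := (neg_le_abs _).trans h
    linarith
  have heN : ∀ i, e i * (1 - e i) ≤ N := fun i => by
    have h : ‖((e i * e i - e i : ℝ) : ℂ)‖ ≤ N :=
      (norm_le_pi_norm (fun i => ((e i * e i - e i : ℝ) : ℂ)) i).trans (le_max_right _ _)
    rw [Complex.norm_real] at h
    have := (neg_le_abs _).trans h
    linarith
  -- With `N = ε ^ 2 / 2`, any `s > ε` with `s * (1 - s) ≤ N` satisfies `1 - s ≤ ε / 2`: eigenvalues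
  -- are either at most `ε` or near `1`.
  obtain ⟨ε, hε, hεN⟩ : ∃ ε : ℝ, 0 ≤ ε ∧ ε ^ 2 = 2 * N :=
    ⟨√(2 * N), Real.sqrt_nonneg _, Real.sq_sqrt (by positivity)⟩
  rw [← hεN]
  refine pow_le_pow_left₀ (le_min (norm_nonneg _) (norm_nonneg _)) ?_ 2
  by_contra! hlt
  obtain ⟨hT1, hT2⟩ := lt_min_iff.mp hlt
  have hex : ∀ {f g : Fin m → ℝ}, (∀ i, 0 ≤ f i) → (∀ i, f i ≤ 1) → (∀ i, g i ≤ 1) →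
      ε < ‖fun i => ((f i * g i * f i - f i : ℝ) : ℂ)‖ → ∃ i, ε < f i * (1 - f i * g i) := by
    intro f g hf hf1 hg h
    by_contra! hall
    refine h.not_ge ((pi_norm_le_iff_of_nonneg hε).mpr fun i => ?_)
    rw [Complex.norm_real, Real.norm_eq_abs, abs_of_nonpos]
    · linarith [hall i]
    · nlinarith [hf i, hf1 i, hg i, mul_le_one₀ (hf1 i) (hf i) (hf1 i), mul_self_nonneg (f i)]
  -- If both comparisons fail, then `e i` and `d j` exceed `ε`. By the common order, `d` and `e`
  -- both exceed `ε` at one of the indices `i`, `j`; there both are near `1`, so that index is no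
  -- counterexample.
  obtain ⟨i, hi⟩ := hex he0 he1 hd1 hT1
  obtain ⟨j, hj⟩ := hex hd0 hd1 he1 hT2
  have aux : ∀ {s t : ℝ}, 0 ≤ s → s ≤ 1 → 0 ≤ t → t ≤ 1 → s * (1 - s) ≤ N → t * (1 - t) ≤ N →
      ε < s → ε < t → 1 - s * t ≤ ε := by
    intro s t hs hs1 ht ht1 hsN htN hεs hεt
    have h1 : 1 - s ≤ ε / 2 := by nlinarith
    have h2 : 1 - t ≤ ε / 2 := by nlinarith
    nlinarith
  have hei : ε < e i := hi.trans_le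
    (mul_le_of_le_one_right (he0 i) (sub_le_self _ (mul_nonneg (he0 i) (hd0 i))))
  have hdj : ε < d j := hj.trans_le
    (mul_le_of_le_one_right (hd0 j) (sub_le_self _ (mul_nonneg (hd0 j) (he0 j))))
  have hi' : ε < 1 - e i * d i := hi.trans_le
    (mul_le_of_le_one_left (by nlinarith [he0 i, hd0 i, he1 i, hd1 i]) (he1 i))
  have hj' : ε < 1 - d j * e j := hj.trans_le
    (mul_le_of_le_one_left (by nlinarith [he0 j, hd0 j, he1 j, hd1 j]) (hd1 j))
  rcases hde i j with h | h
  · exact hj'.not_ge (aux (hd0 j) (hd1 j) (he0 j) (he1 j) (hdN j) (heN j) hdj (hei.trans_le h.2))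
  · exact hi'.not_ge (aux (he0 i) (he1 i) (hd0 i) (hd1 i) (heN i) (hdN i) hei (hdj.trans_le h.1))

end CStarMatrix

/-! ### Comparison of projections -/

/-- An element `w` of `pAq` such that `w⋆ w` is close to `q` witnesses that `q` is equivalent to a
subprojection of `p`. -/
theorem IsStarProjection.exists_murrayVonNeumannEquiv {A : Type*} [CStarAlgebra A] {p q w : A}
    (hq : IsStarProjection q) (hpw : p * w = w) (hwq : w * q = w)
    (h : ‖star w * w - q‖ < 1) :
    ∃ r : A, IsStarProjection r ∧ p * r = r ∧ MurrayVonNeumannEquiv q r := by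
  let _ := CStarAlgebra.spectralOrder A
  have := CStarAlgebra.spectralOrderedRing A
  have hqw : q * (star w * w) = star w * w := by
    rw [← mul_assoc]
    conv_lhs => rw [← hq.isSelfAdjoint.star_eq, ← star_mul, hwq]
  have hqq : q * q = q := hq.isIdempotentElem
  -- Adding `1 - q` makes `w⋆ w` invertible in `A` and not just in the corner `qAq`. As `g` commutes
  -- with `q`, the element `w * g ^ (-1/2)` is the partial isometry in the polar decomposition of
  -- `w`.
  set g := 1 - q + star w * w with hg
  have hg1 : g - 1 = star w * w - q := by rw [hg]; abel
  have hgs : IsSelfAdjoint (g - 1) := by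
    rw [hg1]; exact (IsSelfAdjoint.star_mul_self w).sub hq.isSelfAdjoint
  have hpos : IsStrictlyPositive g := by
    have h1 := hgs.neg_algebraMap_norm_le_self
    have h2 : algebraMap ℝ A (1 - ‖g - 1‖) ≤ g := by
      rw [map_sub, map_one]
      have := add_le_add_left h1 1
      rw [← sub_nonneg] at this ⊢
      convert this using 1; abel
    refine IsStrictlyPositive.of_le ?_ h2
    rw [Algebra.algebraMap_eq_smul_one]
    exact IsStrictlyPositive.smul (by rw [hg1]; linarith) isStrictlyPositive_one
  have hqg : q * g = star w * w := by rw [hg, mul_add, mul_sub, mul_one, hqq, sub_self, zero_add, hqw]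
  have hcomm : Commute g q := by
    rw [Commute, SemiconjBy, hqg, hg, add_mul, sub_mul, one_mul, hqq, sub_self, zero_add,
      mul_assoc, hwq]
  set c := g ^ (-(1 / 2) : ℝ) with hc
  have hcg : c * g * c = 1 := CFC.conjugate_rpow_neg_one_half g hpos
  have hcq : Commute c q := hcomm.cfc_nnreal _
  have hcs : star c = c := (CFC.rpow_nonneg (a := g) (y := -(1 / 2))).isSelfAdjoint.star_eq
  have hv : star (w * c) * (w * c) = q := by
    rw [star_mul, hcs, mul_assoc, ← mul_assoc (star w), ← hqg, ← mul_assoc, ← mul_assoc, hcq.eq,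
      mul_assoc q c g, mul_assoc, hcg, mul_one]
  have hvq : w * c * q = w * c := by rw [mul_assoc, hcq.eq, ← mul_assoc, hwq]
  refine ⟨w * c * star (w * c), ⟨?_, .mul_star_self _⟩, ?_, w * c, hv, rfl⟩
  · rw [IsIdempotentElem, mul_assoc, ← mul_assoc (star (w * c)), hv, ← mul_assoc, hvq]
  · rw [← mul_assoc, ← mul_assoc, hpw]

/-- Projections in a pseudomatricial algebra are comparable. -/
theorem IsPseudomatricial.exists_subprojection {A : Type*} [CStarAlgebra A]
    (hA : IsPseudomatricial A) {p q : A} (hp : IsStarProjection p) (hq : IsStarProjection q) :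
    (∃ r : A, IsStarProjection r ∧ p * r = r ∧ MurrayVonNeumannEquiv q r) ∨
      ∃ r : A, IsStarProjection r ∧ q * r = r ∧ MurrayVonNeumannEquiv p r := by
  let a (n : ℕ) (i : Fin n) : CStarTerm n := .mul (.star (.var i)) (.var i)
  let ψ : CStarFormula 3 := .conn (k := 2) ⟨fun t => min (t 0) (t 1), by fun_prop⟩
    ![.norm (.add (.mul (.mul (.mul (.mul (a 3 2) (.star (.var 0))) (a 3 1)) (.var 0)) (a 3 2))
        (.smul (-1) (a 3 2))),
      .norm (.add (.mul (.mul (.mul (.mul (a 3 1) (.var 0)) (a 3 2)) (.star (.var 0))) (a 3 1))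
        (.smul (-1) (a 3 1)))]
  -- Squaring the infimum avoids a square root of the idempotency error.
  let φ : CStarFormula 2 := .conn (k := 3)
    ⟨fun t => t 0 ^ 2 - 2 * max (t 1) (t 2), by fun_prop⟩
    ![.inf ψ, .norm (.add (.mul (a 2 0) (a 2 0)) (.smul (-1) (a 2 0))),
      .norm (.add (.mul (a 2 1) (a 2 1)) (.smul (-1) (a 2 1)))]
  have hnorm : ∀ {e : A}, IsStarProjection e → ‖e‖ ≤ 1 := fun he => he.norm_le
  have h := hA.eval_nonpos φ (fun m hm v hv => by
    have : NeZero m := ⟨by omega⟩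
    obtain ⟨u, hu, hle⟩ := CStarMatrix.exists_min_norm_sq_le (v 0) (v 1) (hv 0) (hv 1)
    have hinf := ψ.eval_inf_le_eval hv hu
    have h0 : 0 ≤ ψ.inf.eval _ v :=
      Real.iInf_nonneg fun _ => le_min (norm_nonneg _) (norm_nonneg _)
    have hsq := pow_le_pow_left₀ h0 hinf 2
    simp only [ψ, a, CStarFormula.eval, CStarTerm.eval, ContinuousMap.coe_mk,
      Matrix.cons_val_zero, Matrix.cons_val_one, Matrix.cons_val, neg_smul, one_smul,
      ← sub_eq_add_neg] at hsq hle
    simp only [φ, ψ, a, CStarFormula.eval, CStarTerm.eval, ContinuousMap.coe_mk,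
      Matrix.cons_val_zero, Matrix.cons_val_one, Matrix.cons_val, neg_smul, one_smul,
      ← sub_eq_add_neg]
    linarith) ![p, q] (by
      intro i
      fin_cases i
      exacts [hnorm hp, hnorm hq])
  have hpp : star p * p = p := by rw [hp.isSelfAdjoint.star_eq, hp.isIdempotentElem]
  have hqq : star q * q = q := by rw [hq.isSelfAdjoint.star_eq, hq.isIdempotentElem]
  have hinf : ψ.inf.eval A ![p, q] < 1 := by
    have h' : ψ.inf.eval A ![p, q] ^ 2 ≤ 0 := by
      have hp0 : star p * p * (star p * p) - star p * p = 0 := by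
        rw [hpp, hp.isIdempotentElem, sub_self]
      have hq0 : star q * q * (star q * q) - star q * q = 0 := by
        rw [hqq, hq.isIdempotentElem, sub_self]
      change ψ.inf.eval A ![p, q] ^ 2 - 2 * max
        ‖star p * p * (star p * p) + (-1 : ℂ) • (star p * p)‖
        ‖star q * q * (star q * q) + (-1 : ℂ) • (star q * q)‖ ≤ 0 at h
      simpa only [neg_smul, one_smul, ← sub_eq_add_neg, hp0, hq0, norm_zero, max_self, mul_zero,
        sub_zero] using h
    nlinarith
  obtain ⟨u, -, hu⟩ := CStarFormula.exists_eval_lt ψ hinf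
  change min ‖star q * q * star u * (star p * p) * u * (star q * q) + (-1 : ℂ) • (star q * q)‖
    ‖star p * p * u * (star q * q) * star u * (star p * p) + (-1 : ℂ) • (star p * p)‖ < 1 at hu
  simp only [neg_smul, one_smul, ← sub_eq_add_neg, hpp, hqq] at hu
  rcases min_lt_iff.mp hu with hu | hu
  · refine .inl (hq.exists_murrayVonNeumannEquiv (w := p * u * q) ?_ ?_ ?_)
    · rw [← mul_assoc, ← mul_assoc, hp.isIdempotentElem]
    · rw [mul_assoc, hq.isIdempotentElem]
    · convert hu using 1
      congr 2
      simp only [star_mul, hp.isSelfAdjoint.star_eq, hq.isSelfAdjoint.star_eq, mul_assoc]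
      rw [← mul_assoc p p, hp.isIdempotentElem]
  · refine .inr (hp.exists_murrayVonNeumannEquiv (w := q * star u * p) ?_ ?_ ?_)
    · rw [← mul_assoc, ← mul_assoc, hq.isIdempotentElem]
    · rw [mul_assoc, hp.isIdempotentElem]
    · convert hu using 1
      congr 2
      simp only [star_mul, star_star, hp.isSelfAdjoint.star_eq, hq.isSelfAdjoint.star_eq, mul_assoc]
      rw [← mul_assoc q q, hq.isIdempotentElem]

/-! ### Traces and strict comparison -/

theorem IsTracialState.le_of_mul_eq {A : Type*} [NonUnitalCStarAlgebra A] {τ : A →L[ℂ] ℂ}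
    (hτ : IsTracialState τ) {p r : A} (hp : IsStarProjection p) (hr : IsStarProjection r)
    (h : p * r = r) : τ r ≤ τ p := by
  have hsub : IsStarProjection (p - r) := hr.sub_of_mul_eq_right hp h
  have := hτ.nonneg (p - r)
  rwa [hsub.isSelfAdjoint.star_eq, hsub.isIdempotentElem, map_sub, sub_nonneg] at this

theorem IsTracialState.eq_of_murrayVonNeumannEquiv {A : Type*} [NonUnitalCStarAlgebra A]
    {τ : A →L[ℂ] ℂ} (hτ : IsTracialState τ) {p q : A} (h : MurrayVonNeumannEquiv p q) :
    τ p = τ q := by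
  obtain ⟨v, rfl, rfl⟩ := h
  exact hτ.map_mul_comm _ _

theorem proposition6p8 {A : Type*} [NonUnitalCStarAlgebra A] (hA : IsPseudomatricial A) :
    (∃ τ : A →L[ℂ] ℂ, IsTracialState τ) ∧
      ∀ τ : A →L[ℂ] ℂ, IsTracialState τ →
        ∀ p q : A, IsStarProjection p → IsStarProjection q → τ q < τ p →
          ∃ r : A, IsProperSubprojection r p ∧ MurrayVonNeumannEquiv q r := by
  rename_i i
  obtain ⟨j, rfl⟩ := NonUnitalCStarAlgebra.exists_eq_toNonUnitalCStarAlgebra hA.exists_one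
  refine ⟨hA.exists_isTracialState, fun τ hτ p q hp hq hlt => ?_⟩
  rcases hA.exists_subprojection hp hq with ⟨r, hr, hpr, hqr⟩ | ⟨r, hr, hqr, hpr⟩
  · refine ⟨r, ⟨hr, hpr, ?_⟩, hqr⟩
    rintro rfl
    exact hlt.ne (hτ.eq_of_murrayVonNeumannEquiv hqr)
  · refine absurd hlt (not_lt_of_ge ?_)
    rw [hτ.eq_of_murrayVonNeumannEquiv hpr]
    exact hτ.le_of_mul_eq hq hr hqr
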